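/- Let $q$ be an odd prime power and let $m \ge 2$ be an integer. A packing of order $v$ and block size $k$ is a set of $v$ points with a family of $k$-subsets (blocks) such that any two distinct points lie together in at most one block. It is maximum if no packing of order $v$ and block size $k$ has more blocks, cyclic if its point set is $\mathbb{Z}/v\mathbb{Z}$ and $B+1$ is a block for every block $B$, and $r$-even-free if for no $i$ with $1 \le i \le r$ there are $i$ distinct blocks such that every point lies in an even number of them. Then there exists a maximum cyclic $(2q-1)$-even-free packing of order $q^m-1$ and block size $q$. Moreover, such a packing can be obtained from the points and lines of the affine geometry $\mathrm{AG}(m,q)$ as follows. There is an automorphism $\sigma$ of $\mathrm{AG}(m,q)$ (a permutation of the points that maps the set of lines onto itself) which fixes one point $p$ and permutes the other $q^m-1$ points in a single cycle; the lines through $p$ form a single orbit under $\langle\sigma\rangle$; and the packing is the set system obtained by removing $p$ and all lines through $p$, with the remaining points identified with $\mathbb{Z}/(q^m-1)\mathbb{Z}$ in such a way that $\sigma$ becomes $i \mapsto i+1$. -/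

import Mathlib

universe u

/-! A set system on a point type `V` is given by its family of blocks `B : Set (Set V)`. -/

namespace CyclicPacking

/-- `B` is the block family of a packing of order `v` and block size `k` (a `2-(v,k,1)` packing):
there are exactly `v` points, finitely many, every block has exactly `k` points, and two distinct
points lie together in at most one block. -/
def IsPacking {V : Type u} (v k : ℕ) (B : Set (Set V)) : Prop :=
  Finite V ∧ Nat.card V = v ∧ (∀ b ∈ B, b.ncard = k) ∧
    ∀ x y : V, x ≠ y → ∀ b ∈ B, ∀ c ∈ B, x ∈ b → y ∈ b → x ∈ c → y ∈ c → b = c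

/-- A packing is maximum if it has the largest number of blocks among *all* packings
(not only the cyclic ones) of the same order and block size. -/
def IsMaximumPacking {V : Type u} (v k : ℕ) (B : Set (Set V)) : Prop :=
  IsPacking v k B ∧
    ∀ (W : Type u) (C : Set (Set W)), IsPacking v k C → C.ncard ≤ B.ncard

/-- A set system on the points `ℤ/v` is cyclic if the translate by `1` of a block is a block. -/
def IsCyclicSystem {v : ℕ} (B : Set (Set (ZMod v))) : Prop :=
  ∀ b ∈ B, (fun x => x + 1) '' b ∈ B

/-- Every point lies in an even number of blocks of `C`. (The points outside the blocks of `C` lie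
in zero of them, so that it does not matter which point set containing these blocks is used.) -/
def IsEvenConfig {V : Type u} (C : Set (Set V)) : Prop :=
  ∀ a : V, Even {b | b ∈ C ∧ a ∈ b}.ncard

/-- `B` is `r`-even-free: for `1 ≤ i ≤ r`, no `i` blocks of `B` form an even configuration. -/
def IsEvenFree {V : Type u} (r : ℕ) (B : Set (Set V)) : Prop :=
  ∀ i : ℕ, 1 ≤ i → i ≤ r → ¬ ∃ C : Set (Set V), C ⊆ B ∧ C.Finite ∧ C.ncard = i ∧ IsEvenConfig C

/-- The bijection `τ` is an isomorphism of set systems. -/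
def IsIsomorphism {V W : Type u} (B : Set (Set V)) (C : Set (Set W)) (τ : V ≃ W) : Prop :=
  (fun b => τ '' b) '' B = C

/-- The set system of the points and lines of the affine geometry `AG(m, F)`: the points are the
vectors of `F ^ m`, the blocks are the lines through two distinct points. -/
def affineLines (m : ℕ) (F : Type u) [Field F] : Set (Set (Fin m → F)) :=
  {L | ∃ x y : Fin m → F, x ≠ y ∧ L = (affineSpan F {x, y} : Set (Fin m → F))}

/-- The set system obtained from `B` by removing the point `p` and all blocks through `p`. -/
def deletePoint {V : Type u} (B : Set (Set V)) (p : V) : Set (Set {x : V // x ≠ p}) :=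
  {b | Subtype.val '' b ∈ B}

/-- The orbit of a set of points under the group generated by the permutation `σ`. -/
def blockOrbit {V : Type u} (σ : Equiv.Perm V) (b : Set V) : Set (Set V) :=
  {c | ∃ i : ℤ, c = (σ ^ i) '' b}

end CyclicPacking

/-! Write `q = |F|`. The lines of a vector space `V` over `F` form a packing in which any two points
are joined. After deleting the point `0`, each remaining point `x` is still joined to all points
outside its line through `0`, so its degree attains Johnson's bound `⌊(v - 1) / (k - 1)⌋`, which
makes the induced packing maximum. A Singer cycle of `V`, i.e. multiplication by a generator of the
multiplicative group of the field of order `|V|`, acts on the remaining points as a single cycle.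

Now let `C` be an even configuration of fewer than `2q` lines and let `L₀ ∈ C`. A line other than
`L₀` lies in a common level hyperplane with `L₀` for at most `1 / q` of the functionals that are
constant on `L₀`, so for some such functional `f` the hyperplane `f = c` containing `L₀` contains at
most one further line of `C`. Let `t` be the number of lines of `C` on which `f` is not constant. As
`q` is odd, counting incidences of `C` with `f = d` shows that the number of lines of `C` in `f = d`
is congruent to `t` modulo `2` for every `d`. The points of `f = c` on just one of the lines of `C`
in this hyperplane lie on pairwise distinct lines counted by `t`.
* If `L₀` is the only line of `C` in `f = c`, then `t ≥ q`, and `t` is odd, so each of the `q`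
  parallel hyperplanes contains a line of `C`; in total `|C| ≥ 2q`.
* If there is a second line, then `t ≥ 2q - 2`, and again `|C| ≥ 2q`.
-/

namespace CyclicPacking

section SetSystems

variable {V P : Type*} {A C : Set (Set V)} {b : Set V} {x : V}

/-- The degree of a point `x` in a set system `B`, i.e. the number of blocks through `x`. -/
noncomputable def degree (B : Set (Set V)) (x : V) : ℕ :=
  {b | b ∈ B ∧ x ∈ b}.ncard

/-- The set system induced by `A` on the range of `ι`, with `P` as its point set: its blocks are
the blocks of `A` all of whose points have a label in `P`. -/
def induced (A : Set (Set V)) (ι : P → V) : Set (Set P) :=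
  {b | ι '' b ∈ A}

theorem sum_degree_eq_sum_ncard_inter (C : Finset (Set V)) (S : Finset V) :
    ∑ x ∈ S, degree (C : Set (Set V)) x = ∑ b ∈ C, (b ∩ S).ncard := by
  classical
  have hdegree (x : V) : degree (C : Set (Set V)) x = (C.bipartiteAbove (· ∈ ·) x).card := by
    rw [← Set.ncard_coe_finset, Finset.coe_bipartiteAbove]
    rfl
  have hinter (b : Set V) : (b ∩ S).ncard = (S.bipartiteBelow (· ∈ ·) b).card := by
    rw [← Set.ncard_coe_finset, Finset.coe_bipartiteBelow, Set.inter_comm]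
    rfl
  simp only [hdegree, hinter, Finset.sum_card_bipartiteAbove_eq_sum_card_bipartiteBelow]

theorem IsEvenConfig.even_ncard_odd_inter (h : IsEvenConfig C) (hC : C.Finite) {S : Set V}
    (hS : S.Finite) : Even {b | b ∈ C ∧ Odd (b ∩ S).ncard}.ncard := by
  lift C to Finset (Set V) using hC
  lift S to Finset V using hS
  have hsum : Even (∑ b ∈ C, (b ∩ S).ncard) := by
    rw [← sum_degree_eq_sum_ncard_inter]
    exact Finset.even_sum _ fun x _ => h x
  rwa [Finset.even_sum_iff_even_card_odd, ← Set.ncard_coe_finset, Finset.coe_filter] at hsum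

theorem IsEvenConfig.exists_ne_mem (h : IsEvenConfig C) (hb : b ∈ C) (hx : x ∈ b) :
    ∃ c ∈ C, c ≠ b ∧ x ∈ c := by
  by_contra! hunique
  have hsingleton : {c | c ∈ C ∧ x ∈ c} = {b} :=
    Set.eq_singleton_iff_unique_mem.2
      ⟨⟨hb, hx⟩, fun c hc => by_contra fun hne => hunique c hc.1 hne hc.2⟩
  have heven := h x
  rw [hsingleton, Set.ncard_singleton] at heven
  exact Nat.not_even_one heven

theorem IsEvenConfig.image {ι : P → V} (hι : ι.Injective) {C : Set (Set P)}
    (h : IsEvenConfig C) : IsEvenConfig ((ι '' ·) '' C) := by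
  intro x
  by_cases hx : x ∈ Set.range ι
  · obtain ⟨a, rfl⟩ := hx
    convert h a using 1
    rw [← Set.ncard_image_of_injective _ hι.image_injective]
    congr 1
    ext b
    constructor
    · rintro ⟨⟨c, hc, rfl⟩, ha⟩
      exact ⟨c, ⟨hc, (hι.mem_set_image).1 ha⟩, rfl⟩
    · rintro ⟨c, ⟨hc, ha⟩, rfl⟩
      exact ⟨⟨c, hc, rfl⟩, Set.mem_image_of_mem ι ha⟩
  · have hempty : {b | b ∈ (ι '' ·) '' C ∧ x ∈ b} = ∅ := by
      refine Set.eq_empty_of_forall_notMem ?_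
      rintro _ ⟨⟨c, -, rfl⟩, hxc⟩
      exact hx (Set.image_subset_range ι c hxc)
    rw [hempty, Set.ncard_empty]
    exact Even.zero

protected theorem IsEvenFree.induced {r : ℕ} (hA : IsEvenFree r A) {ι : P → V} (hι : ι.Injective) :
    IsEvenFree r (induced A ι) := by
  rintro i hi hir ⟨C, hC, hfin, hcard, heven⟩
  exact hA i hi hir ⟨(ι '' ·) '' C, Set.image_subset_iff.2 hC, hfin.image _,
    by rwa [Set.ncard_image_of_injective _ hι.image_injective], heven.image hι⟩

end SetSystems

section Packings

variable {V : Type*} {v k : ℕ} {A B : Set (Set V)} {b c : Set V} {x y : V}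

theorem IsPacking.finite (hB : IsPacking v k B) : Finite V := hB.1

theorem IsPacking.natCard_eq (hB : IsPacking v k B) : Nat.card V = v := hB.2.1

theorem IsPacking.ncard_eq (hB : IsPacking v k B) (hb : b ∈ B) : b.ncard = k :=
  hB.2.2.1 b hb

theorem IsPacking.eq_of_mem (hB : IsPacking v k B) (hxy : x ≠ y) (hb : b ∈ B) (hc : c ∈ B)
    (hxb : x ∈ b) (hyb : y ∈ b) (hxc : x ∈ c) (hyc : y ∈ c) : b = c :=
  hB.2.2.2 x y hxy b hb c hc hxb hyb hxc hyc

/-- The points joined to `x`, i.e. those that lie on a common block of `B` with `x`. -/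
def neighbors (B : Set (Set V)) (x : V) : Set V :=
  {y | y ≠ x ∧ ∃ b ∈ B, x ∈ b ∧ y ∈ b}

theorem IsPacking.ncard_mul_eq_sum_degree [Fintype V] (hB : IsPacking v k B) :
    B.ncard * k = ∑ x, degree B x := by
  lift B to Finset (Set V) using Set.toFinite B
  rw [sum_degree_eq_sum_ncard_inter, Set.ncard_coe_finset, Finset.sum_const_nat (m := k)]
  intro b hb
  rw [Finset.coe_univ, Set.inter_univ, hB.ncard_eq hb]

theorem IsPacking.degree_mul_pred_eq_ncard_neighbors (hB : IsPacking v k B) (x : V) :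
    degree B x * (k - 1) = (neighbors B x).ncard := by
  have := hB.finite
  have hneighbors : neighbors B x = ⋃ b ∈ {b | b ∈ B ∧ x ∈ b}, b \ {x} := by
    ext y
    simp only [neighbors, Set.mem_ofPred_eq, Set.mem_iUnion, Set.mem_sdiff, Set.mem_singleton_iff,
      exists_prop]
    tauto
  have hdisjoint : {b | b ∈ B ∧ x ∈ b}.PairwiseDisjoint (· \ {x}) := by
    rintro b ⟨hb, hxb⟩ c ⟨hc, hxc⟩ hbc
    refine Set.disjoint_left.2 fun y ⟨hyb, hyx⟩ ⟨hyc, _⟩ => hbc ?_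
    exact hB.eq_of_mem (Ne.symm hyx) hb hc hxb hyb hxc hyc
  have hcard : ∀ b ∈ {b | b ∈ B ∧ x ∈ b}, (b \ {x}).ncard = k - 1 := fun b hb => by
    rw [Set.ncard_sdiff_singleton_of_mem hb.2, hB.ncard_eq hb.1]
  rw [hneighbors, (Set.toFinite _).ncard_biUnion (fun _ _ => Set.toFinite _) hdisjoint,
    finsum_mem_congr rfl hcard, finsum_mem_eq_finite_toFinset_sum _ (Set.toFinite _),
    Finset.sum_const, smul_eq_mul, ← Set.ncard_eq_toFinset_card]
  rfl

theorem IsPacking.degree_le (hB : IsPacking v k B) (hk : 1 < k) (x : V) :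
    degree B x ≤ (v - 1) / (k - 1) := by
  have := hB.finite
  rw [Nat.le_div_iff_mul_le (Nat.sub_pos_of_lt hk), hB.degree_mul_pred_eq_ncard_neighbors,
    ← hB.natCard_eq, ← Set.ncard_singleton x, ← Set.ncard_compl]
  exact Set.ncard_le_ncard fun y hy => hy.1

/-- Johnson's bound. -/
theorem IsPacking.ncard_mul_le (hB : IsPacking v k B) (hk : 1 < k) :
    B.ncard * k ≤ v * ((v - 1) / (k - 1)) := by
  have := hB.finite
  have := Fintype.ofFinite V
  calc B.ncard * k = ∑ x, degree B x := hB.ncard_mul_eq_sum_degree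
    _ ≤ ∑ _x : V, (v - 1) / (k - 1) := Finset.sum_le_sum fun x _ => hB.degree_le hk x
    _ = v * ((v - 1) / (k - 1)) := by
      rw [Finset.sum_const, smul_eq_mul, Finset.card_univ, ← Nat.card_eq_fintype_card,
        hB.natCard_eq]

theorem IsPacking.isMaximumPacking_of_le_degree (hB : IsPacking v k B) (hk : 1 < k)
    (hdegree : ∀ x, (v - 1) / (k - 1) ≤ degree B x) : IsMaximumPacking v k B := by
  refine ⟨hB, fun W C hC => Nat.le_of_mul_le_mul_right ?_ (zero_lt_one.trans hk)⟩
  have := hB.finite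
  have := Fintype.ofFinite V
  calc C.ncard * k ≤ v * ((v - 1) / (k - 1)) := hC.ncard_mul_le hk
    _ = ∑ _x : V, (v - 1) / (k - 1) := by
      rw [Finset.sum_const, smul_eq_mul, Finset.card_univ, ← Nat.card_eq_fintype_card,
        hB.natCard_eq]
    _ ≤ ∑ x, degree B x := Finset.sum_le_sum fun x _ => hdegree x
    _ = B.ncard * k := hB.ncard_mul_eq_sum_degree.symm

variable {P : Type*} {ι : P → V} {p : V}

protected theorem IsPacking.induced (hA : IsPacking v k A) (hι : ι.Injective) :
    IsPacking (Nat.card P) k (induced A ι) := by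
  have := hA.finite
  refine ⟨Finite.of_injective ι hι, rfl, fun b hb => ?_,
    fun x y hxy b hb c hc hxb hyb hxc hyc => ?_⟩
  · rw [← Set.ncard_image_of_injective b hι, hA.ncard_eq hb]
  · exact hι.image_injective (hA.eq_of_mem (hι.ne hxy) hb hc
      (Set.mem_image_of_mem ι hxb) (Set.mem_image_of_mem ι hyb)
      (Set.mem_image_of_mem ι hxc) (Set.mem_image_of_mem ι hyc))

theorem IsPacking.compl_preimage_subset_neighbors_induced (hA : IsPacking v k A)
    (hjoin : ∀ x y, x ≠ y → ∃ b ∈ A, x ∈ b ∧ y ∈ b) (hι : ι.Injective) (hrange : Set.range ι = {p}ᶜ)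
    (hb : b ∈ A) (hpb : p ∈ b) {x : P} (hxb : ι x ∈ b) :
    (ι ⁻¹' b)ᶜ ⊆ neighbors (induced A ι) x := by
  intro y hyb
  have hyx : y ≠ x := by
    rintro rfl
    exact hyb hxb
  have hxp : ι x ≠ p := hrange.subset (Set.mem_range_self x)
  obtain ⟨c, hc, hxc, hyc⟩ := hjoin (ι x) (ι y) (hι.ne hyx.symm)
  have hpc : p ∉ c := fun hpc => hyb (hA.eq_of_mem hxp hc hb hxc hpc hxb hpb ▸ hyc)
  refine ⟨hyx, ι ⁻¹' c, ?_, hxc, hyc⟩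
  change ι '' (ι ⁻¹' c) ∈ A
  rwa [Set.image_preimage_eq_of_subset]
  rw [hrange]
  rintro z hz rfl
  exact hpc hz

theorem IsPacking.isMaximumPacking_induced (hA : IsPacking v k A) (hk : 1 < k)
    (hjoin : ∀ x y, x ≠ y → ∃ b ∈ A, x ∈ b ∧ y ∈ b) (hι : ι.Injective)
    (hrange : Set.range ι = {p}ᶜ) : IsMaximumPacking (v - 1) k (induced A ι) := by
  have := hA.finite
  have := Finite.of_injective ι hι
  have hP : Nat.card P = v - 1 := by
    rw [← Set.ncard_univ, ← Set.ncard_image_of_injective _ hι, Set.image_univ, hrange,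
      Set.ncard_compl, Set.ncard_singleton, hA.natCard_eq]
  have hpacking := hA.induced hι
  rw [hP] at hpacking
  refine hpacking.isMaximumPacking_of_le_degree hk fun x => ?_
  obtain ⟨b, hb, hxb, hpb⟩ := hjoin (ι x) p (hrange.subset (Set.mem_range_self x))
  have hb' : (ι ⁻¹' b).ncard = k - 1 := by
    rw [← Set.ncard_image_of_injective _ hι, Set.image_preimage_eq_inter_range, hrange,
      ← Set.sdiff_eq, Set.ncard_sdiff_singleton_of_mem hpb, hA.ncard_eq hb]
  have hneighbors : v - 1 - (k - 1) ≤ degree (induced A ι) x * (k - 1) := by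
    rw [hpacking.degree_mul_pred_eq_ncard_neighbors, ← hP, ← hb', ← Set.ncard_compl]
    exact Set.ncard_le_ncard
      (hA.compl_preimage_subset_neighbors_induced hjoin hι hrange hb hpb hxb)
  have : 0 < v - 1 := hP ▸ Nat.card_pos_iff.2 ⟨⟨x⟩, inferInstance⟩
  rw [← Nat.lt_succ_iff, Nat.div_lt_iff_lt_mul (Nat.sub_pos_of_lt hk), Nat.succ_mul]
  omega

end Packings

section Automorphisms

variable {V P : Type u} {v k n : ℕ} {A : Set (Set V)} {σ : Equiv.Perm V} {p : V}

theorem IsIsomorphism.zpow (hσ : IsIsomorphism A A σ) (i : ℤ) : IsIsomorphism A A (σ ^ i) := by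
  open scoped Pointwise in
  have hstabilizer (π : Equiv.Perm V) :
      IsIsomorphism A A π ↔ π ∈ MulAction.stabilizer (Equiv.Perm V) A := Iff.rfl
  rw [hstabilizer] at hσ ⊢
  exact zpow_mem hσ i

theorem IsIsomorphism.image_mem (hσ : IsIsomorphism A A σ) {b : Set V} (hb : b ∈ A) :
    σ '' b ∈ A :=
  hσ.subset (Set.mem_image_of_mem _ hb)

theorem IsPacking.setOf_mem_eq_blockOrbit (hA : IsPacking v k A) (hk : 1 < k)
    (hσ : IsIsomorphism A A σ) (hcycle : σ.IsCycleOn {p}ᶜ) {b : Set V} (hb : b ∈ A) (hpb : p ∈ b) :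
    {c | c ∈ A ∧ p ∈ c} = blockOrbit σ b := by
  have hp : σ p = p := of_not_not (mt hcycle.apply_mem_iff.1 (by simp))
  have hfix (i : ℤ) : (σ ^ i) p = p := Equiv.Perm.zpow_apply_eq_self_of_apply_eq_self hp i
  have hexists {c : Set V} (hc : c ∈ A) : ∃ x ∈ c, x ≠ p :=
    Set.exists_ne_of_one_lt_ncard (hA.ncard_eq hc ▸ hk) p
  ext c
  constructor
  · rintro ⟨hc, hpc⟩
    obtain ⟨x, hxb, hxp⟩ := hexists hb
    obtain ⟨y, hyc, hyp⟩ := hexists hc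
    obtain ⟨i, rfl⟩ := hcycle.2 hxp hyp
    exact ⟨i, hA.eq_of_mem hyp hc ((hσ.zpow i).image_mem hb) hyc hpc
      (Set.mem_image_of_mem _ hxb) ⟨p, hpb, hfix i⟩⟩
  · rintro ⟨i, rfl⟩
    exact ⟨(hσ.zpow i).image_mem hb, p, hpb, hfix i⟩

theorem isCycleOn_range_of_map_add_one {ι : ZMod n → V} (hι : ∀ i, ι (i + 1) = σ (ι i)) :
    σ.IsCycleOn (Set.range ι) := by
  have hadd (i : ZMod n) (z : ℤ) : σ.SameCycle (ι i) (ι (i + z)) := by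
    induction z with
    | zero => simpa using Equiv.Perm.SameCycle.refl σ (ι i)
    | succ z ih => simpa [← add_assoc, hι] using ih
    | pred z ih =>
      rw [← Equiv.Perm.sameCycle_apply_right, ← hι]
      simpa [add_assoc] using ih
  refine ⟨⟨?_, σ.injective.injOn, ?_⟩, ?_⟩
  · rintro _ ⟨i, rfl⟩
    exact ⟨i + 1, hι i⟩
  · rintro _ ⟨i, rfl⟩
    exact ⟨ι (i - 1), Set.mem_range_self _, by rw [← hι, sub_add_cancel]⟩
  · rintro _ ⟨i, rfl⟩ _ ⟨j, rfl⟩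
    obtain ⟨z, hz⟩ := ZMod.intCast_surjective (j - i)
    simpa [hz] using hadd i z

theorem IsIsomorphism.isCyclicSystem_induced (hσ : IsIsomorphism A A σ) {ι : ZMod n → V}
    (hι : ∀ i, ι (i + 1) = σ (ι i)) : IsCyclicSystem (induced A ι) := by
  intro b hb
  have himage : ι '' ((· + 1) '' b) = σ '' (ι '' b) := by
    rw [Set.image_image, Set.image_image]
    exact Set.image_congr fun i _ => hι i
  change ι '' ((· + 1) '' b) ∈ A
  rw [himage]
  exact hσ.image_mem hb

theorem isIsomorphism_induced_deletePoint (A : Set (Set V)) (τ : P ≃ {x : V // x ≠ p}) :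
    IsIsomorphism (induced A (Subtype.val ∘ τ)) (deletePoint A p) τ := by
  have hpreimage : induced A (Subtype.val ∘ τ) = (τ '' ·) ⁻¹' deletePoint A p := by
    ext b
    change (Subtype.val ∘ τ) '' b ∈ A ↔ Subtype.val '' (τ '' b) ∈ A
    rw [Set.image_comp]
  rw [IsIsomorphism, hpreimage]
  exact Set.image_preimage_eq _ τ.surjective.image_surjective

end Automorphisms

/-- The lines of an arbitrary vector space; for `F ^ m` they are the blocks in `affineLines`. -/
def IsLine (F : Type*) {V : Type*} [Field F] [AddCommGroup V] [Module F V] (L : Set V) : Prop :=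
  ∃ x y : V, x ≠ y ∧ L = (affineSpan F {x, y} : Set V)

section Lines

variable {F V : Type*} [Field F] [AddCommGroup V] [Module F V] {L : Set V} {x y : V}

theorem coe_affineSpan_pair_eq_range_lineMap (x y : V) :
    (affineSpan F {x, y} : Set V) = Set.range (AffineMap.lineMap x y : F → V) :=
  Set.ext fun _ => mem_affineSpan_pair_iff_exists_lineMap_eq

theorem exists_isLine (hxy : x ≠ y) : ∃ L : Set V, IsLine F L ∧ x ∈ L ∧ y ∈ L :=
  ⟨_, ⟨x, y, hxy, rfl⟩, left_mem_affineSpan_pair F x y, right_mem_affineSpan_pair F x y⟩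

theorem IsLine.nonempty (hL : IsLine F L) : L.Nonempty := by
  obtain ⟨x, y, -, rfl⟩ := hL
  exact ⟨x, left_mem_affineSpan_pair F x y⟩

theorem IsLine.ncard_eq (hL : IsLine F L) : L.ncard = Nat.card F := by
  obtain ⟨x, y, hxy, rfl⟩ := hL
  rw [coe_affineSpan_pair_eq_range_lineMap,
    Set.ncard_range_of_injective (AffineMap.lineMap_injective F hxy)]

theorem IsLine.eq_affineSpan_pair (hL : IsLine F L) (hx : x ∈ L) (hy : y ∈ L) (hxy : x ≠ y) :
    L = (affineSpan F {x, y} : Set V) := by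
  obtain ⟨z, w, -, rfl⟩ := hL
  rw [affineSpan_pair_eq_of_mem_of_mem_of_ne hx hy hxy]

theorem isPacking_lines [Finite V] :
    IsPacking (Nat.card V) (Nat.card F) {L : Set V | IsLine F L} :=
  ⟨inferInstance, rfl, fun _ hL => IsLine.ncard_eq hL, fun _ _ hxy _ hL _ hM hxL hyL hxM hyM =>
    (hL.eq_affineSpan_pair hxL hyL hxy).trans (hM.eq_affineSpan_pair hxM hyM hxy).symm⟩

theorem IsLine.injOn_or_subset_preimage (hL : IsLine F L) (f : Module.Dual F V) :
    Set.InjOn f L ∨ ∃ c, L ⊆ f ⁻¹' {c} := by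
  obtain ⟨x, y, -, rfl⟩ := hL
  have hf (t : F) : f (AffineMap.lineMap x y t) = t * (f y - f x) + f x := by
    simp [AffineMap.lineMap_apply]
  rw [coe_affineSpan_pair_eq_range_lineMap]
  by_cases hfxy : f y - f x = 0
  · refine .inr ⟨f x, ?_⟩
    rintro _ ⟨t, rfl⟩
    simp [hf, hfxy]
  · refine .inl ?_
    rintro _ ⟨s, rfl⟩ _ ⟨t, rfl⟩ hst
    rw [hf, hf, add_left_inj, mul_left_inj' hfxy] at hst
    rw [hst]

theorem IsLine.not_injOn_of_subset_preimage (hL : IsLine F L) {f : Module.Dual F V} {c : F}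
    (hLf : L ⊆ f ⁻¹' {c}) : ¬ Set.InjOn f L := by
  obtain ⟨x, y, hxy, rfl⟩ := hL
  have hx := left_mem_affineSpan_pair F x y
  have hy := right_mem_affineSpan_pair F x y
  exact fun hinj => hxy (hinj hx hy ((hLf hx).trans (hLf hy).symm))

theorem IsLine.ncard_inter_preimage_of_injOn [Finite F] (hL : IsLine F L) {f : Module.Dual F V}
    (hLf : Set.InjOn f L) (c : F) : (L ∩ f ⁻¹' {c}).ncard = 1 := by
  have himage : f '' L = Set.univ :=
    Set.eq_of_subset_of_ncard_le (Set.subset_univ _)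
      (by rw [hLf.ncard_image, hL.ncard_eq, Set.ncard_univ])
  obtain ⟨x, hx, hxc⟩ : c ∈ f '' L := himage ▸ Set.mem_univ c
  rw [Set.ncard_eq_one]
  exact ⟨x, Set.eq_singleton_iff_unique_mem.2
    ⟨⟨hx, hxc⟩, fun y ⟨hy, hyc⟩ => hLf hy hx (Eq.trans hyc hxc.symm)⟩⟩

theorem IsLine.odd_ncard_inter_preimage_iff (hF : Odd (Nat.card F)) (hL : IsLine F L)
    (f : Module.Dual F V) (c : F) :
    Odd (L ∩ f ⁻¹' {c}).ncard ↔ Set.InjOn f L ∨ L ⊆ f ⁻¹' {c} := by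
  have : Finite F := Nat.finite_of_card_ne_zero hF.pos.ne'
  constructor
  · intro hodd
    obtain ⟨x, hxL, hxc⟩ := Set.nonempty_of_ncard_ne_zero hodd.pos.ne'
    refine (hL.injOn_or_subset_preimage f).imp_right fun ⟨d, hd⟩ => ?_
    rwa [← show d = c from (hd hxL).symm.trans hxc]
  · rintro (hinj | hsub)
    · rw [hL.ncard_inter_preimage_of_injOn hinj]
      exact odd_one
    · rwa [Set.inter_eq_left.2 hsub, hL.ncard_eq]

end Lines

theorem isIsomorphism_lines {F : Type*} {V W : Type u} [Field F] [AddCommGroup V] [Module F V]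
    [AddCommGroup W] [Module F W] (e : V ≃ₗ[F] W) :
    IsIsomorphism {L : Set V | IsLine F L} {L : Set W | IsLine F L} e.toEquiv := by
  have himage (x y : V) : e '' affineSpan F {x, y} = affineSpan F {e x, e y} := by
    rw [← Set.image_pair]
    exact congrArg SetLike.coe (AffineSubspace.map_span e.toAffineEquiv.toAffineMap {x, y})
  ext L
  constructor
  · rintro ⟨_, ⟨x, y, hxy, rfl⟩, rfl⟩
    exact ⟨e x, e y, e.injective.ne hxy, himage x y⟩
  · rintro ⟨x, y, hxy, rfl⟩
    exact ⟨_, ⟨e.symm x, e.symm y, e.symm.injective.ne hxy, rfl⟩, (himage _ _).trans (by simp)⟩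

/-- The blocks of `C` on which `f` is injective. For a family `C` of lines and a functional `f ≠ 0`,
these are the lines that meet every hyperplane `f = c` in exactly one point. -/
def transversals {V W : Type*} (C : Set (Set V)) (f : V → W) : Set (Set V) :=
  {L | L ∈ C ∧ Set.InjOn f L}

/-- The blocks of `C` contained in `H`, which is usually a hyperplane `f ⁻¹' {c}`. -/
def blocksIn {V : Type*} (C : Set (Set V)) (H : Set V) : Set (Set V) :=
  {L | L ∈ C ∧ L ⊆ H}

theorem ncard_transversals_add_ncard_le {V W : Type*} [Finite V] {C D : Set (Set V)} {f : V → W}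
    (hD : D ⊆ C) (hDf : ∀ L ∈ D, ¬ Set.InjOn f L) :
    (transversals C f).ncard + D.ncard ≤ C.ncard := by
  have hdisjoint : Disjoint (transversals C f) D :=
    Set.disjoint_left.2 fun L hL hLD => hDf L hLD hL.2
  rw [← Set.ncard_union_eq hdisjoint]
  exact Set.ncard_le_ncard (Set.union_subset (fun L hL => hL.1) hD)

section EvenConfigurations

variable {F V : Type*} [Field F] [AddCommGroup V] [Module F V] [Finite V]
  {C : Set (Set V)} {L L₀ L₁ : Set V} {f : Module.Dual F V} {c : F}

theorem even_ncard_transversals_add_ncard_blocksIn (hF : Odd (Nat.card F))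
    (hC : ∀ L ∈ C, IsLine F L) (heven : IsEvenConfig C) (f : Module.Dual F V) (c : F) :
    Even ((transversals C f).ncard + (blocksIn C (f ⁻¹' {c})).ncard) := by
  have hdisjoint : Disjoint (transversals C f) (blocksIn C (f ⁻¹' {c})) :=
    Set.disjoint_left.2 fun L hL hLc => (hC L hL.1).not_injOn_of_subset_preimage hLc.2 hL.2
  have hodd : transversals C f ∪ blocksIn C (f ⁻¹' {c}) =
      {L | L ∈ C ∧ Odd (L ∩ f ⁻¹' {c}).ncard} := by
    ext L
    refine Iff.trans and_or_left.symm (and_congr_right fun hL => ?_)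
    exact ((hC L hL).odd_ncard_inter_preimage_iff hF f c).symm
  rw [← Set.ncard_union_eq hdisjoint, hodd]
  exact heven.even_ncard_odd_inter (Set.toFinite C) (Set.toFinite _)

theorem ncard_le_ncard_transversals (hC : ∀ L ∈ C, IsLine F L) {S : Set V} (hS : S ⊆ f ⁻¹' {c})
    (hcover : ∀ x ∈ S, ∃ L ∈ C, x ∈ L ∧ ¬ L ⊆ f ⁻¹' {c}) :
    S.ncard ≤ (transversals C f).ncard := by
  choose! line hline hmem hnot using hcover
  have hinj (x : V) (hx : x ∈ S) : Set.InjOn f (line x) := by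
    refine ((hC _ (hline x hx)).injOn_or_subset_preimage f).resolve_right ?_
    rintro ⟨d, hd⟩
    obtain rfl : d = c := (hd (hmem x hx)).symm.trans (hS hx)
    exact hnot x hx hd
  refine Set.ncard_le_ncard_of_injOn line (fun x hx => ⟨hline x hx, hinj x hx⟩) ?_
  intro x hx y hy hxy
  exact hinj x hx (hmem x hx) (hxy ▸ hmem y hy) ((hS hx).trans (hS hy).symm)

theorem two_mul_natCard_le_ncard_of_blocksIn_eq_singleton (hF : Odd (Nat.card F))
    (hC : ∀ L ∈ C, IsLine F L) (heven : IsEvenConfig C)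
    (hblocks : blocksIn C (f ⁻¹' {c}) = {L₀}) : 2 * Nat.card F ≤ C.ncard := by
  have : Finite F := Nat.finite_of_card_ne_zero hF.pos.ne'
  obtain ⟨hL₀, hL₀c⟩ : L₀ ∈ blocksIn C (f ⁻¹' {c}) := hblocks ▸ Set.mem_singleton L₀
  have htransversals : Nat.card F ≤ (transversals C f).ncard := by
    rw [← (hC L₀ hL₀).ncard_eq]
    refine ncard_le_ncard_transversals hC hL₀c fun x hx => ?_
    obtain ⟨L, hL, hne, hxL⟩ := heven.exists_ne_mem hL₀ hx
    exact ⟨L, hL, hxL, fun hLc => hne (hblocks.subset ⟨hL, hLc⟩)⟩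
  have hodd : Odd (transversals C f).ncard := by
    have := even_ncard_transversals_add_ncard_blocksIn hF hC heven f c
    rwa [hblocks, Set.ncard_singleton, Nat.even_add_one, Nat.not_even_iff_odd] at this
  have hparallel (d : F) : ∃ L ∈ C, L ⊆ f ⁻¹' {d} := by
    have := even_ncard_transversals_add_ncard_blocksIn hF hC heven f d
    have hoddBlocks := (Nat.even_add'.1 this).1 hodd
    exact Set.nonempty_of_ncard_ne_zero hoddBlocks.pos.ne'
  choose line hline hlineSubset using hparallel
  have hinj : line.Injective := fun d e hde => by
    obtain ⟨x, hx⟩ := (hC _ (hline d)).nonempty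
    exact (hlineSubset d hx).symm.trans (hlineSubset e (hde ▸ hx))
  have hrange : (Set.range line).ncard = Nat.card F := Set.ncard_range_of_injective hinj
  have htotal := ncard_transversals_add_ncard_le (f := f) (Set.range_subset_iff.2 hline)
    (Set.forall_mem_range.2 fun d =>
      (hC _ (hline d)).not_injOn_of_subset_preimage (hlineSubset d))
  lia

theorem IsLine.natCard_le_ncard_sdiff_add_one (hL : IsLine F L) (hL₀ : IsLine F L₀) (hne : L ≠ L₀) :
    Nat.card F ≤ (L \ L₀).ncard + 1 := by
  have hinter : (L ∩ L₀).ncard ≤ 1 := by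
    refine (Set.ncard_le_one).2 fun x hx y hy => by_contra fun hxy => hne ?_
    exact (hL.eq_affineSpan_pair hx.1 hy.1 hxy).trans (hL₀.eq_affineSpan_pair hx.2 hy.2 hxy).symm
  rw [← hL.ncard_eq, ← Set.ncard_inter_add_ncard_sdiff_eq_ncard L L₀, add_comm]
  exact Nat.add_le_add_left hinter _

theorem two_mul_natCard_le_ncard_of_blocksIn_eq_pair (hC : ∀ L ∈ C, IsLine F L)
    (heven : IsEvenConfig C) (hne : L₀ ≠ L₁) (hblocks : blocksIn C (f ⁻¹' {c}) = {L₀, L₁}) :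
    2 * Nat.card F ≤ C.ncard := by
  obtain ⟨⟨hL₀, hL₀c⟩, hL₁, hL₁c⟩ := Set.pair_subset_iff.1 hblocks.superset
  have hcover {L M : Set V} (hL : L ∈ C) (hLM : blocksIn C (f ⁻¹' {c}) = {L, M}) :
      ∀ x ∈ L \ M, ∃ N ∈ C, x ∈ N ∧ ¬ N ⊆ f ⁻¹' {c} := fun x hx => by
    obtain ⟨N, hN, hNL, hxN⟩ := heven.exists_ne_mem hL hx.1
    refine ⟨N, hN, hxN, fun hNc => ?_⟩
    obtain rfl | rfl := hLM.subset ⟨hN, hNc⟩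
    exacts [hNL rfl, hx.2 hxN]
  have hpoints : (L₀ \ L₁ ∪ L₁ \ L₀).ncard ≤ (transversals C f).ncard :=
    ncard_le_ncard_transversals hC
      (Set.union_subset (Set.sdiff_subset.trans hL₀c) (Set.sdiff_subset.trans hL₁c))
      fun x hx => hx.elim (hcover hL₀ hblocks x) (hcover hL₁ (hblocks.trans (Set.pair_comm _ _)) x)
  rw [Set.ncard_union_eq disjoint_sdiff_sdiff] at hpoints
  have hpair : ∀ L ∈ ({L₀, L₁} : Set (Set V)), ¬ Set.InjOn f L := by
    rintro L (rfl | rfl)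
    exacts [(hC _ hL₀).not_injOn_of_subset_preimage hL₀c,
      (hC _ hL₁).not_injOn_of_subset_preimage hL₁c]
  have htotal := ncard_transversals_add_ncard_le (Set.pair_subset hL₀ hL₁) hpair
  rw [Set.ncard_pair hne] at htotal
  have hcard₀ := (hC L₀ hL₀).natCard_le_ncard_sdiff_add_one (hC L₁ hL₁) hne
  have hcard₁ := (hC L₁ hL₁).natCard_le_ncard_sdiff_add_one (hC L₀ hL₀) hne.symm
  lia

end EvenConfigurations

theorem exists_ncard_setOf_rel_lt {α β : Type*} [Finite α] [Nonempty α] (r : α → β → Prop)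
    {t : Set β} (ht : t.Finite) {k n : ℕ} (hr : ∀ b ∈ t, {a | r a b}.ncard * n ≤ Nat.card α)
    (hcard : t.ncard < k * n) : ∃ a, {b | b ∈ t ∧ r a b}.ncard < k := by
  classical
  have := Fintype.ofFinite α
  lift t to Finset β using ht
  by_contra! hk
  have habove (a : α) : {b | b ∈ (t : Set β) ∧ r a b}.ncard = (t.bipartiteAbove r a).card := by
    rw [← Set.ncard_coe_finset, Finset.coe_bipartiteAbove]
    rfl
  have hbelow (b : β) : {a | r a b}.ncard = (Finset.univ.bipartiteBelow r b).card := by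
    rw [← Set.ncard_coe_finset, Finset.coe_bipartiteBelow]
    simp
  refine hcard.not_ge (le_of_mul_le_mul_left ?_ (Nat.card_pos (α := α)))
  calc Nat.card α * (k * n) = (∑ _a : α, k) * n := by simp [mul_assoc]
    _ ≤ (∑ a, (t.bipartiteAbove r a).card) * n :=
      Nat.mul_le_mul_right n (Finset.sum_le_sum fun a _ => habove a ▸ hk a)
    _ = ∑ b ∈ t, {a | r a b}.ncard * n := by
      rw [Finset.sum_card_bipartiteAbove_eq_sum_card_bipartiteBelow, Finset.sum_mul]
      simp only [hbelow]
    _ ≤ ∑ _b ∈ t, Nat.card α := Finset.sum_le_sum hr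
    _ = Nat.card α * (t : Set β).ncard := by simp [mul_comm]

section HyperplaneChoice

variable {F V : Type*} [Field F] [AddCommGroup V] [Module F V] {C : Set (Set V)} {L L₀ : Set V}
  {x : V}

theorem natCard_ker_mul_natCard {M : Type*} [AddCommGroup M] [Module F M] {ψ : Module.Dual F M}
    (hψ : ψ ≠ 0) : Nat.card ψ.ker * Nat.card F = Nat.card M := by
  rw [Submodule.card_eq_card_quotient_mul_card ψ.ker,
    Nat.card_congr (ψ.quotKerEquivOfSurjective (LinearMap.surjective hψ)).toEquiv]

theorem IsLine.exists_mem_sub_notMem_vectorSpan (hL : IsLine F L) (hL₀ : IsLine F L₀)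
    (hne : L ≠ L₀) (hx : x ∈ L₀) : ∃ z ∈ L, z - x ∉ vectorSpan F L₀ := by
  obtain ⟨z, hz, hz₀⟩ : ∃ z ∈ L, z ∉ L₀ := by
    by_contra! hsub
    obtain ⟨z, w, hzw, rfl⟩ := hL
    exact hne (hL₀.eq_affineSpan_pair (hsub z (left_mem_affineSpan_pair F z w))
      (hsub w (right_mem_affineSpan_pair F z w)) hzw).symm
  refine ⟨z, hz, fun hzx => hz₀ ?_⟩
  obtain ⟨u, v, -, rfl⟩ := hL₀
  rwa [← vsub_eq_sub, ← direction_affineSpan, AffineSubspace.affineSpan_coe,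
    AffineSubspace.vsub_right_mem_direction_iff_mem hx] at hzx

theorem IsLine.ncard_subset_preimage_mul_le [Finite F] [Finite V] (hL : IsLine F L)
    (hL₀ : IsLine F L₀) (hne : L ≠ L₀) (hx : x ∈ L₀) :
    {f : (vectorSpan F L₀).dualAnnihilator | L ⊆ f.1 ⁻¹' {f.1 x}}.ncard * Nat.card F ≤
      Nat.card (vectorSpan F L₀).dualAnnihilator := by
  obtain ⟨z, hz, hzx⟩ := hL.exists_mem_sub_notMem_vectorSpan hL₀ hne hx
  let ψ : Module.Dual F (vectorSpan F L₀).dualAnnihilator :=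
    (Module.Dual.eval F V (z - x)).domRestrict _
  have hψ : ψ ≠ 0 := by
    obtain ⟨f, hfz, hf⟩ := Submodule.exists_dual_map_eq_bot_of_notMem hzx inferInstance
    intro h
    have := LinearMap.congr_fun h ⟨f, by
      rw [Submodule.mem_dualAnnihilator]
      exact fun w hw => (Submodule.eq_bot_iff _).1 hf _ (Submodule.mem_map_of_mem hw)⟩
    exact hfz this
  have : Finite (Module.Dual F V) := DFunLike.finite _
  rw [← natCard_ker_mul_natCard (M := (vectorSpan F L₀).dualAnnihilator) hψ]
  refine Nat.mul_le_mul_right _ ?_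
  change _ ≤ (ψ.ker : Set (vectorSpan F L₀).dualAnnihilator).ncard
  refine Set.ncard_le_ncard fun f hf => ?_
  change f.1 (z - x) = 0
  rw [map_sub, sub_eq_zero]
  exact hf hz

theorem exists_ncard_blocksIn_le_one [Finite F] [Finite V] (hC : ∀ L ∈ C, IsLine F L)
    (hcard : C.ncard < 2 * Nat.card F) (hL₀ : IsLine F L₀) (hL₀C : L₀ ∉ C) :
    ∃ (f : Module.Dual F V) (c : F),
      L₀ ⊆ f ⁻¹' {c} ∧ (blocksIn C (f ⁻¹' {c})).ncard ≤ 1 := by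
  obtain ⟨x, hx⟩ := hL₀.nonempty
  have hconst (f : (vectorSpan F L₀).dualAnnihilator) : L₀ ⊆ f.1 ⁻¹' {f.1 x} := fun y hy => by
    have := (Submodule.mem_dualAnnihilator _).1 f.2 _ (vsub_mem_vectorSpan F hy hx)
    rwa [vsub_eq_sub, map_sub, sub_eq_zero] at this
  have : Finite (Module.Dual F V) := DFunLike.finite _
  obtain ⟨f, hf⟩ := exists_ncard_setOf_rel_lt
    (fun (f : (vectorSpan F L₀).dualAnnihilator) L => L ⊆ f.1 ⁻¹' {f.1 x}) (Set.toFinite C)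
    (fun L hL => (hC L hL).ncard_subset_preimage_mul_le hL₀ (ne_of_mem_of_not_mem hL hL₀C) hx)
    hcard
  exact ⟨f.1, f.1 x, hconst f, Nat.lt_succ_iff.1 hf⟩

end HyperplaneChoice

theorem isEvenFree_lines {F V : Type*} [Field F] [AddCommGroup V] [Module F V] [Finite V]
    (hF : Odd (Nat.card F)) : IsEvenFree (2 * Nat.card F - 1) {L : Set V | IsLine F L} := by
  have : Finite F := Nat.finite_of_card_ne_zero hF.pos.ne'
  rintro i hi hir ⟨C, hC, -, rfl, heven⟩
  have hlt : C.ncard < 2 * Nat.card F := by lia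
  refine hlt.not_ge ?_
  obtain ⟨L₀, hL₀⟩ := Set.nonempty_of_ncard_ne_zero (Nat.one_le_iff_ne_zero.1 hi)
  obtain ⟨f, c, hL₀c, hle⟩ := exists_ncard_blocksIn_le_one (C := C \ {L₀})
    (fun L hL => hC hL.1) ((Set.ncard_le_ncard Set.sdiff_subset).trans_lt hlt) (hC hL₀)
    fun h => h.2 rfl
  have hblocks : blocksIn C (f ⁻¹' {c}) = insert L₀ (blocksIn (C \ {L₀}) (f ⁻¹' {c})) := by
    ext L
    by_cases hL : L = L₀
    · simp [blocksIn, hL, hL₀, hL₀c]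
    · simp [blocksIn, hL]
  obtain hempty | ⟨L₁, hL₁⟩ := (Set.ncard_le_one_iff_subsingleton.1 hle).eq_empty_or_singleton
  · rw [hempty, insert_empty_eq] at hblocks
    exact two_mul_natCard_le_ncard_of_blocksIn_eq_singleton hF hC heven hblocks
  · rw [hL₁] at hblocks
    have hne : L₀ ≠ L₁ := fun h => (hL₁.superset rfl : L₁ ∈ blocksIn _ _).1.2 h.symm
    exact two_mul_natCard_le_ncard_of_blocksIn_eq_pair hC heven hne hblocks

/-- The witness is multiplication by a generator of the multiplicative group of the extension of `F`
of degree `finrank F V`, transported to `V`. -/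
theorem exists_singer_cycle (F V : Type*) [Field F] [AddCommGroup V] [Module F V] [Finite V]
    [Nontrivial V] [Finite F] :
    ∃ (σ : V ≃ₗ[F] V) (τ : ZMod (Nat.card V - 1) ≃ {x : V // x ≠ 0}),
      ∀ i, (τ (i + 1) : V) = σ (τ i) := by
  obtain ⟨p, _⟩ := CharP.exists F
  have : Fact p.Prime := ⟨CharP.char_is_prime F p⟩
  have : NeZero (Module.finrank F V) := ⟨Module.finrank_pos.ne'⟩
  let E := FiniteField.Extension F p (Module.finrank F V)
  let e : E ≃ₗ[F] V := LinearEquiv.ofFinrankEq _ _ (FiniteField.finrank_extension F p _)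
  have hunits : Nat.card Eˣ = Nat.card V - 1 := by
    rw [Nat.card_units, Nat.card_congr e.toEquiv]
  let φ : Multiplicative (ZMod (Nat.card Eˣ)) ≃* Eˣ := zmodCyclicMulEquiv inferInstance
  rw [← hunits]
  refine ⟨e.symm ≪≫ₗ DistribMulAction.toLinearEquiv F E (φ (.ofAdd 1)) ≪≫ₗ e,
    Multiplicative.ofAdd.trans (φ.toEquiv.trans (unitsEquivNeZero.trans
      (e.toEquiv.subtypeEquiv fun _ => e.map_ne_zero_iff.symm))), fun i => ?_⟩
  simp [add_comm i, ofAdd_add, Units.smul_def]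

end CyclicPacking

theorem proposition2p9 (q m : ℕ) (hq : IsPrimePow q) (hodd : Odd q) (hm : 2 ≤ m) :
    ∃ B : Set (Set (ZMod (q ^ m - 1))),
      CyclicPacking.IsMaximumPacking (q ^ m - 1) q B ∧
      CyclicPacking.IsCyclicSystem B ∧
      CyclicPacking.IsEvenFree (2 * q - 1) B ∧
      -- `B` comes from `AG(m, q)`, by removing the fixed point `p` of an automorphism `σ` that is a
      -- cycle on the other points, together with the blocks through `p`, which are one `σ`-orbit
      ∃ (F : Type) (_ : Field F), Nat.card F = q ∧
        ∃ (σ : Equiv.Perm (Fin m → F)) (p : Fin m → F),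
          CyclicPacking.IsIsomorphism
            (CyclicPacking.affineLines m F) (CyclicPacking.affineLines m F) σ ∧
          σ p = p ∧
          (∃ L ∈ CyclicPacking.affineLines m F,
            {c | c ∈ CyclicPacking.affineLines m F ∧ p ∈ c} = CyclicPacking.blockOrbit σ L) ∧
          ∃ τ : ZMod (q ^ m - 1) ≃ {x : Fin m → F // x ≠ p},
            (∀ i, ((τ (i + 1) : {x : Fin m → F // x ≠ p}) : Fin m → F) = σ (τ i)) ∧
            CyclicPacking.IsIsomorphism B
              (CyclicPacking.deletePoint (CyclicPacking.affineLines m F) p) τ := by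
  open CyclicPacking in
  obtain ⟨F, _, rfl⟩ : ∃ (F : Type) (_ : Field F), Nat.card F = q :=
    have : Nonempty (Field (Fin q)) := Fintype.nonempty_field_iff.2 (by simpa using hq)
    ⟨Fin q, this.some, Nat.card_fin q⟩
  have : Finite F := Nat.finite_of_card_ne_zero hq.pos.ne'
  have : Nonempty (Fin m) := ⟨⟨0, by lia⟩⟩
  have hcard : Nat.card (Fin m → F) = Nat.card F ^ m := by rw [Nat.card_fun, Nat.card_fin]
  obtain ⟨σ, τ, hτ⟩ := exists_singer_cycle F (Fin m → F)
  have hpacking : IsPacking _ _ {L : Set (Fin m → F) | IsLine F L} := isPacking_lines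
  rw [← hcard]
  have hinj : Function.Injective (Subtype.val ∘ τ) := Subtype.val_injective.comp τ.injective
  have hrange : Set.range (Subtype.val ∘ τ) = {0}ᶜ :=
    (τ.surjective.range_comp _).trans Subtype.range_coe_subtype
  have hcycle : Equiv.Perm.IsCycleOn σ.toEquiv {0}ᶜ := hrange ▸ isCycleOn_range_of_map_add_one hτ
  obtain ⟨x, hx⟩ := exists_ne (0 : Fin m → F)
  obtain ⟨L, hL, hL0, -⟩ := exists_isLine (F := F) hx.symm
  exact ⟨induced {L | IsLine F L} (Subtype.val ∘ τ),
    hpacking.isMaximumPacking_induced Finite.one_lt_card (fun _ _ => exists_isLine) hinj hrange,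
    (isIsomorphism_lines σ).isCyclicSystem_induced hτ, (isEvenFree_lines hodd).induced hinj,
    F, _, rfl, σ.toEquiv, 0, isIsomorphism_lines σ, map_zero σ,
    ⟨L, hL, hpacking.setOf_mem_eq_blockOrbit Finite.one_lt_card (isIsomorphism_lines σ)
      hcycle hL hL0⟩, τ, hτ, isIsomorphism_induced_deletePoint _ τ⟩
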